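/- Let $0\le r\le n$. A lattice path from $(0,0)$ to $(n-r,r)$ with unit north and east steps is identified with the increasing sequence of the positions of its $r$ north steps. Let $P=(p_1<\dots<p_r)$ and $Q=(q_1<\dots<q_r)$ be two such paths with $p_j\le q_j$ for all $j$, and let $\mathsf M[P,Q]$ be the lattice path matroid on $[n]$ whose bases are the sets $\{i_1<\dots<i_r\}$ with $p_j\le i_j\le q_j$ for all $j$. For a matroid $\mathsf M$ on $[n]$, let $\mathcal P_{\mathsf M}\subset\mathbb R^n$ be its matroid polytope, the convex hull of the vectors $e_B=\sum_{i\in B}e_i$ over the bases $B$ of $\mathsf M$. A subdivision of a polytope is a finite polytopal complex that covers the polytope and has the same vertices. A subdivision $\Sigma$ of $\mathcal P_{\mathsf M[P,Q]}$ is an LPM subdivision if every maximal cell of $\Sigma$ is the matroid polytope $\mathcal P_{\mathsf M[P',Q']}$ of a lattice path matroid on $[n]$. A vector $w=(w_B)$ of real numbers indexed by the bases of $\mathsf M[P,Q]$ is a weight vector for $\Sigma$ if the cells of $\Sigma$ are exactly the projections to $\mathbb R^n$ of the lower faces of $\operatorname{conv}\{(e_B,w_B)\}\subset\mathbb R^{n}\times\mathbb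 R$ (together with the empty cell). The local Dressian $\mathrm{Dr}(\mathsf M)$ of a matroid $\mathsf M$ of rank $r$ on $[n]$ is the set of all real vectors $w$ indexed by the bases of $\mathsf M$ that lie in the tropical hypersurface of every polynomial obtained from a three-term Plücker relation $$p_{S\cup\{i,j\}}\,p_{S\cup\{k,l\}}-p_{S\cup\{i,k\}}\,p_{S\cup\{j,l\}}+p_{S\cup\{i,l\}}\,p_{S\cup\{j,k\}},\qquad |S|=r-2,\quad i<j<k<l\ \text{in}\ [n]\setminus S,$$ by setting $p_B=0$ for every $B$ that is not a basis of $\mathsf M$. Here the tropical hypersurface of a nonzero polynomial is the set of points at which the minimum of its tropical monomials is attained at least twice, and the zero polynomial imposes no condition. **Corollary.** Let $\Sigma$ be an LPM subdivision of $\mathcal P_{\mathsf M[P,Q]}$ and let $w_\Sigma$ be a weight vector for $\Sigma$. Then $w_\Sigma\in\mathrm{Dr}(\mathsf M[P,Q])$. -/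

import Mathlib

noncomputable section

/-! ### Lattice paths and lattice path matroids -/

/-- A path with `n` unit steps, `r` of them north and the others east, given by the increasing
sequence of the positions of its north steps. The positions are `0, …, n - 1`. -/
abbrev NEPath (r n : ℕ) : Type := Fin r ↪o Fin n

/-- `B` is the set of north steps of a lattice path lying between `P` and `Q`. -/
def IsBetween {r n : ℕ} (P Q : NEPath r n) (B : Set (Fin n)) : Prop :=
  ∃ I : NEPath r n, (∀ j, P j ≤ I j ∧ I j ≤ Q j) ∧ B = Set.range I

/-- The number of elements of `A` that are smaller than `t`. -/
def countBelow {n : ℕ} (A : Finset (Fin n)) (t : ℕ) : ℕ := (A.filter (fun x => x.val < t)).card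

theorem countBelow_zero {n : ℕ} (A : Finset (Fin n)) : countBelow A 0 = 0 := by
  simp [countBelow]

theorem countBelow_top {n : ℕ} (A : Finset (Fin n)) : countBelow A n = A.card := by
  simp [countBelow]

theorem countBelow_insert {n : ℕ} (A : Finset (Fin n)) (b : Fin n) (hb : b ∉ A) (t : ℕ) :
    countBelow (insert b A) t = countBelow A t + if b.val < t then 1 else 0 := by
  unfold countBelow
  rw [Finset.filter_insert]
  split_ifs with h
  · rw [Finset.card_insert_of_notMem (by simp [hb])]
  · rfl

theorem countBelow_erase {n : ℕ} (A : Finset (Fin n)) (a : Fin n) (ha : a ∈ A) (t : ℕ) :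
    countBelow (A.erase a) t + (if a.val < t then 1 else 0) = countBelow A t := by
  rw [← countBelow_insert _ _ (Finset.notMem_erase a A), Finset.insert_erase ha]

theorem countBelow_succ {n : ℕ} (A : Finset (Fin n)) (x : Fin n) :
    countBelow A (x.val + 1) = countBelow A x.val + if x ∈ A then 1 else 0 := by
  unfold countBelow
  split_ifs with h
  · have : A.filter (fun y => y.val < x.val + 1) = insert x (A.filter (fun y => y.val < x.val)) := by
      ext y
      simp only [Finset.mem_filter, Finset.mem_insert, Fin.ext_iff]
      constructor
      · rintro ⟨h1, h2⟩
        by_cases h3 : y.val = x.val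
        · exact Or.inl h3
        · exact Or.inr ⟨h1, by omega⟩
      · rintro (h1 | ⟨h1, h2⟩)
        · rw [Fin.ext h1]; exact ⟨h, by omega⟩
        · exact ⟨h1, by omega⟩
    rw [this, Finset.card_insert_of_notMem (by simp)]
  · congr 1
    ext y
    simp only [Finset.mem_filter]
    refine and_congr_right fun hy => ⟨fun h1 => ?_, fun h1 => by omega⟩
    have : y.val ≠ x.val := fun h2 => h (Fin.ext h2 ▸ hy)
    omega

theorem countBelow_map {r n : ℕ} (I : NEPath r n) (t : ℕ) :
    countBelow (Finset.univ.map I.toEmbedding) t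
      = (Finset.univ.filter (fun j => (I j).val < t)).card := by
  unfold countBelow
  rw [Finset.filter_map, Finset.card_map]
  rfl

theorem path_le_iff {r n : ℕ} (I J : NEPath r n) :
    (∀ j, I j ≤ J j) ↔ ∀ t, countBelow (Finset.univ.map J.toEmbedding) t
      ≤ countBelow (Finset.univ.map I.toEmbedding) t := by
  simp only [countBelow_map]
  constructor
  · intro h t
    refine Finset.card_le_card fun j hj => ?_
    simp only [Finset.mem_filter, Finset.mem_univ, true_and] at hj ⊢
    exact lt_of_le_of_lt (h j) hj
  · intro h j
    by_contra hj
    rw [not_le] at hj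
    have h1 := h (I j).val
    have h2 : (Finset.univ.filter (fun i => (I i).val < (I j).val)).card
        < (Finset.univ.filter (fun i => (J i).val < (I j).val)).card := by
      refine Finset.card_lt_card ⟨fun i hi => ?_, fun hs => ?_⟩
      · simp only [Finset.mem_filter, Finset.mem_univ, true_and, Fin.val_fin_lt,
          OrderEmbedding.lt_iff_lt] at hi ⊢
        exact lt_trans (J.lt_iff_lt.2 hi) hj
      · have := hs (x := j) (by simpa using hj)
        simp at this
    omega

theorem isBetween_iff {r n : ℕ} (P Q : NEPath r n) (B : Finset (Fin n)) :
    IsBetween P Q (B : Set (Fin n)) ↔ B.card = r ∧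
      ∀ t, countBelow (Finset.univ.map Q.toEmbedding) t ≤ countBelow B t ∧
        countBelow B t ≤ countBelow (Finset.univ.map P.toEmbedding) t := by
  constructor
  · rintro ⟨I, hI, hB⟩
    have hB' : B = Finset.univ.map I.toEmbedding := by
      apply Finset.coe_injective
      rw [hB]; simp
    subst hB'
    exact ⟨by simp, fun t => ⟨(path_le_iff I Q).1 (fun j => (hI j).2) t,
      (path_le_iff P I).1 (fun j => (hI j).1) t⟩⟩
  · rintro ⟨hc, h⟩
    have hB : Finset.univ.map (B.orderEmbOfFin hc).toEmbedding = B :=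
      Finset.map_orderEmbOfFin_univ B hc
    refine ⟨B.orderEmbOfFin hc, fun j => ⟨?_, ?_⟩, (Finset.range_orderEmbOfFin B hc).symm⟩
    · exact (path_le_iff P _).2 (fun t => by rw [hB]; exact (h t).2) j
    · exact (path_le_iff _ Q).2 (fun t => by rw [hB]; exact (h t).1) j

theorem exists_above {n : ℕ} (A B : Finset (Fin n)) (hAB : A.card = B.card) (a : Fin n)
    (h : countBelow B (a.val + 1) < countBelow A (a.val + 1)) :
    ∃ b ∈ B, b ∉ A ∧ a < b ∧ ∀ s, a.val < s → s ≤ b.val → countBelow B s < countBelow A s := by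
  by_contra hcon
  push Not at hcon
  have key : ∀ t, a.val + 1 ≤ t → t ≤ n →
      ∀ s, a.val < s → s ≤ t → countBelow B s < countBelow A s := by
    intro t ht
    induction t, ht using Nat.le_induction with
    | base =>
      intro _ s h1 h2
      rw [show s = a.val + 1 by omega]; exact h
    | succ t ht ih =>
      intro htn s h1 h2
      have ih' := ih (by omega)
      rcases Nat.lt_or_ge t s with h3 | h3
      · rw [show s = t + 1 by omega]
        have hA := countBelow_succ A ⟨t, by omega⟩
        have hB := countBelow_succ B ⟨t, by omega⟩
        simp only at hA hB
        have := ih' t (by omega) le_rfl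
        by_cases hb : (⟨t, by omega⟩ : Fin n) ∈ B
        · by_cases ha : (⟨t, by omega⟩ : Fin n) ∈ A
          · rw [if_pos ha] at hA; rw [if_pos hb] at hB; omega
          · obtain ⟨s', q1, q2, q3⟩ := hcon _ hb ha (by rw [Fin.lt_def]; simp only; omega)
            have := ih' s' q1 q2
            omega
        · rw [if_neg hb] at hB; omega
      · exact ih' s h1 h3
  have := key n (by omega) le_rfl n (by omega) le_rfl
  rw [countBelow_top, countBelow_top] at this
  omega

theorem exists_below {n : ℕ} (A B : Finset (Fin n)) (a : Fin n)
    (h : countBelow A a.val < countBelow B a.val) :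
    ∃ b ∈ B, b ∉ A ∧ b < a ∧ ∀ s, b.val < s → s ≤ a.val → countBelow A s < countBelow B s := by
  by_contra hcon
  push Not at hcon
  have key : ∀ d, d ≤ a.val →
      ∀ s, a.val - d ≤ s → s ≤ a.val → countBelow A s < countBelow B s := by
    intro d
    induction d with
    | zero =>
      intro _ s h1 h2
      rw [show s = a.val by omega]; exact h
    | succ d ih =>
      intro hd s h1 h2
      have ih' := ih (by omega)
      rcases Nat.lt_or_ge s (a.val - d) with h3 | h3
      · have hsn : s < n := by omega
        have hA := countBelow_succ A ⟨s, hsn⟩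
        have hB := countBelow_succ B ⟨s, hsn⟩
        simp only at hA hB
        have := ih' (s + 1) (by omega) (by omega)
        by_cases hb : (⟨s, hsn⟩ : Fin n) ∈ B
        · by_cases ha : (⟨s, hsn⟩ : Fin n) ∈ A
          · rw [if_pos ha] at hA; rw [if_pos hb] at hB; omega
          · obtain ⟨s', q1, q2, q3⟩ := hcon _ hb ha (by rw [Fin.lt_def]; simp only; omega)
            have := ih' s' (by simp only at q1; omega) q2
            omega
        · rw [if_neg hb] at hB; omega
      · exact ih' s h3 h2
  have := key a.val le_rfl 0 (by omega) (by omega)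
  rw [countBelow_zero, countBelow_zero] at this
  omega

theorem isBetween_exchange {r n : ℕ} (P Q : NEPath r n) :
    Matroid.ExchangeProperty (IsBetween P Q) := by
  classical
  intro X Y hX hY a ha
  obtain ⟨A, rfl⟩ : ∃ A : Finset (Fin n), (A : Set (Fin n)) = X := ⟨X.toFinset, by simp⟩
  obtain ⟨B, rfl⟩ : ∃ B : Finset (Fin n), (B : Set (Fin n)) = Y := ⟨Y.toFinset, by simp⟩
  rw [isBetween_iff] at hX hY
  have haA : a ∈ A := by simpa using ha.1
  have haB : a ∉ B := by simpa using ha.2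
  have hA := countBelow_succ A a
  have hB := countBelow_succ B a
  rw [if_pos haA] at hA
  rw [if_neg haB] at hB
  have fin : ∀ b, b ∉ A →
      (∀ t, countBelow (Finset.univ.map Q.toEmbedding) t + (if a.val < t then 1 else 0)
          ≤ countBelow A t + (if b.val < t then 1 else 0) ∧
        countBelow A t + (if b.val < t then 1 else 0)
          ≤ countBelow (Finset.univ.map P.toEmbedding) t + (if a.val < t then 1 else 0)) →
      IsBetween P Q (insert b ((A : Set (Fin n)) \ {a})) := by
    intro b hb h
    have hcoe : (insert b ((A : Set (Fin n)) \ {a})) = ((insert b (A.erase a) : Finset (Fin n)) :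
        Set (Fin n)) := by push_cast; rfl
    have hb' : b ∉ A.erase a := fun h' => hb (Finset.mem_of_mem_erase h')
    rw [hcoe, isBetween_iff]
    refine ⟨?_, fun t => ?_⟩
    · rw [Finset.card_insert_of_notMem hb', Finset.card_erase_of_mem haA, hX.1]
      have : 0 < A.card := Finset.card_pos.2 ⟨a, haA⟩
      omega
    · rw [countBelow_insert _ _ hb']
      have h1 := countBelow_erase A a haA t
      have h2 := h t
      omega
  by_cases hlt : countBelow A a.val < countBelow B a.val
  · obtain ⟨b, hbB, hbA, hba, hs⟩ := exists_below A B a hlt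
    refine ⟨b, ⟨by simpa using hbB, by simpa using hbA⟩, fin b hbA fun t => ?_⟩
    have h1 := hX.2 t
    have h2 := hY.2 t
    have h3 := hs t
    rw [Fin.lt_def] at hba
    split_ifs <;> omega
  · obtain ⟨b, hbB, hbA, hba, hs⟩ := exists_above A B (hX.1.trans hY.1.symm) a (by omega)
    refine ⟨b, ⟨by simpa using hbB, by simpa using hbA⟩, fin b hbA fun t => ?_⟩
    have h1 := hX.2 t
    have h2 := hY.2 t
    have h3 := hs t
    rw [Fin.lt_def] at hba
    split_ifs <;> omega

/-- The lattice path matroid `M[P, Q]` on the ground set `Fin n`: its bases are the sets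
`{i₁ < ⋯ < i_r}` with `p_j ≤ i_j ≤ q_j` for all `j`. -/
def latticePathMatroid {r n : ℕ} (P Q : NEPath r n) (hPQ : ∀ j, P j ≤ Q j) : Matroid (Fin n) :=
  Matroid.ofIsBaseOfFinite (E := Set.univ) Set.finite_univ (IsBetween P Q)
    ⟨Set.range P, P, fun j => ⟨le_rfl, hPQ j⟩, rfl⟩ (isBetween_exchange P Q)
    (fun _ _ => Set.subset_univ _)

/-- `M` is a lattice path matroid on `Fin n`, with its usual order. -/
def IsLatticePathMatroid {n : ℕ} (M : Matroid (Fin n)) : Prop :=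
  ∃ (r : ℕ) (P Q : NEPath r n) (hPQ : ∀ j, P j ≤ Q j), M = latticePathMatroid P Q hPQ

/-! ### Matroid polytopes -/

/-- The bases of `M`, as finite sets. -/
abbrev Bases {n : ℕ} (M : Matroid (Fin n)) : Type :=
  {B : Finset (Fin n) // M.IsBase (B : Set (Fin n))}

/-- The vector `e_B = ∑_{i ∈ B} e_i` of a basis `B`. -/
def baseVector {n : ℕ} (M : Matroid (Fin n)) (B : Bases M) : Fin n → ℝ :=
  fun i => if i ∈ B.1 then 1 else 0

/-- The matroid polytope: the convex hull of the vectors `e_B` of the bases of `M`. -/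
def matroidPolytope {n : ℕ} (M : Matroid (Fin n)) : Set (Fin n → ℝ) :=
  convexHull ℝ (Set.range (baseVector M))

/-! ### Polytopal subdivisions -/

/-- `S` is a polyhedral subdivision of the polytope `K`: a finite polytopal complex that covers `K`
and has the same vertices as `K`. The empty set counts as a face of every polytope. -/
structure IsSubdivision {n : ℕ} (K : Set (Fin n → ℝ)) (S : Set (Set (Fin n → ℝ))) : Prop where
  finite : S.Finite
  polytope : ∀ F ∈ S, ∃ V : Set (Fin n → ℝ), V.Finite ∧ F = convexHull ℝ V
  face_mem : ∀ F ∈ S, ∀ G, IsExposed ℝ F G → G ∈ S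
  inter_face : ∀ F ∈ S, ∀ G ∈ S, IsExposed ℝ F (F ∩ G) ∧ IsExposed ℝ G (F ∩ G)
  covers : ⋃₀ S = K
  vertices : {v | {v} ∈ S} = K.extremePoints ℝ

/-- `S` is a lattice path matroidal subdivision of the matroid polytope of `M`: a subdivision all
of whose maximal cells are polytopes of lattice path matroids. -/
def IsLPMSubdivision {n : ℕ} (M : Matroid (Fin n)) (S : Set (Set (Fin n → ℝ))) : Prop :=
  IsSubdivision (matroidPolytope M) S ∧
    ∀ F, Maximal (· ∈ S) F → ∃ N : Matroid (Fin n), IsLatticePathMatroid N ∧ F = matroidPolytope N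

/-- The convex hull of the points `v i` lifted to the heights `w i`. -/
def liftedPolytope {ι : Type*} {n : ℕ} (v : ι → Fin n → ℝ) (w : ι → ℝ) : Set ((Fin n → ℝ) × ℝ) :=
  convexHull ℝ (Set.range fun i => (v i, w i))

/-- The lower face of the lifted polytope on which the functional `(x, h) ↦ φ x + h`
is minimal. -/
def lowerFace {ι : Type*} {n : ℕ} (v : ι → Fin n → ℝ) (w : ι → ℝ)
    (φ : (Fin n → ℝ) →ₗ[ℝ] ℝ) : Set ((Fin n → ℝ) × ℝ) :=
  {x ∈ liftedPolytope v w | ∀ y ∈ liftedPolytope v w, φ x.1 + x.2 ≤ φ y.1 + y.2}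

/-- The regular subdivision induced by the weights `w`: the projections of the lower faces of the
lifted polytope, together with the empty face. -/
def inducedSubdivision {ι : Type*} {n : ℕ} (v : ι → Fin n → ℝ) (w : ι → ℝ) :
    Set (Set (Fin n → ℝ)) :=
  insert ∅ (Set.range fun φ : (Fin n → ℝ) →ₗ[ℝ] ℝ => Prod.fst '' lowerFace v w φ)

/-- `w` is a weight vector for the subdivision `S` of the matroid polytope of `M`. -/
def IsWeightVectorFor {n : ℕ} (M : Matroid (Fin n)) (w : Bases M → ℝ)
    (S : Set (Set (Fin n → ℝ))) : Prop :=
  inducedSubdivision (baseVector M) w = S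

/-! ### The local Dressian -/

/-- The value at `w` of the tropical monomial with exponent vector `e`. -/
def tropMonomial {σ : Type*} (e : σ →₀ ℕ) (w : σ → ℝ) : ℝ := e.sum fun i k => (k : ℝ) * w i

/-- The tropical hypersurface (min convention, trivial valuation) of `f`: the points at which the
minimum of the tropical monomials of `f` is attained at least twice. It is the whole space
for `f = 0`. -/
def tropHypersurface {σ : Type*} (f : MvPolynomial σ ℚ) : Set (σ → ℝ) :=
  {w | ∀ e ∈ f.support, (∀ e' ∈ f.support, tropMonomial e w ≤ tropMonomial e' w) →
    ∃ e' ∈ f.support, e' ≠ e ∧ tropMonomial e' w = tropMonomial e w}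

/-- The three-term Plücker relation
`p_{Sij} p_{Skl} - p_{Sik} p_{Sjl} + p_{Sil} p_{Sjk}`, for `i < j < k < l` outside `S`. -/
def pluckerRelation {n : ℕ} (S : Finset (Fin n)) (i j k l : Fin n) :
    MvPolynomial (Finset (Fin n)) ℚ :=
  MvPolynomial.X (S ∪ {i, j}) * MvPolynomial.X (S ∪ {k, l})
    - MvPolynomial.X (S ∪ {i, k}) * MvPolynomial.X (S ∪ {j, l})
    + MvPolynomial.X (S ∪ {i, l}) * MvPolynomial.X (S ∪ {j, k})

open Classical in
/-- Setting the variables `p_B` to zero for which `B` is not a basis of `M`. -/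
def restrictToBases {n : ℕ} (M : Matroid (Fin n)) :
    MvPolynomial (Finset (Fin n)) ℚ →ₐ[ℚ] MvPolynomial (Bases M) ℚ :=
  MvPolynomial.aeval fun B =>
    if hB : M.IsBase (B : Set (Fin n)) then MvPolynomial.X ⟨B, hB⟩ else 0

/-- The local Dressian `Dr(M)`, a subset of `ℝ^{bases of M}`: the intersection of the tropical
hypersurfaces of the three-term Plücker relations in the rank of `M`, restricted to the
bases of `M`. -/
def localDressian {n : ℕ} (M : Matroid (Fin n)) : Set (Bases M → ℝ) :=
  {w | ∀ (S : Finset (Fin n)) (i j k l : Fin n), ((S.card + 2 : ℕ) : ℕ∞) = M.eRank →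
    i < j → j < k → k < l → i ∉ S → j ∉ S → k ∉ S → l ∉ S →
    w ∈ tropHypersurface (restrictToBases M (pluckerRelation S i j k l))}

end

/-! An LPM subdivision is matroidal: its maximal cells are matroid polytopes. Weights inducing such
a subdivision satisfy every tropical three-term relation, by a look at the octahedron with vertices
`e_{S ∪ T}`, `T` a pair in `{i, j, k, l}`. Monomials of the restricted relation correspond to
opposite pairs of vertices that are bases of `M`, and all these pairs have the same midpoint, the
centre of the octahedron.

Let a monomial attain the minimum. The centre then lies in the polytope of `M`, hence in a maximal
cell, the polytope of a matroid `N`. By `isBase_of_cell`, bases of `N` are bases of `M` and minimize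
`φ + w` for one linear `φ`. By `exists_complementary_pair`, `N` has an opposite pair of bases in the
octahedron, and base exchange (`isBase_complementary_pair`) gives a second one. Since `φ` has the
same sum on all opposite pairs, both pairs attain the minimum. Their monomials differ, so at least
one differs from the given monomial. -/

/-! ### Convex combinations of base vectors -/

/-- If a weighted mean of values bounded by `c` equals `c`, all values of nonzero weight are `c`. -/
theorem eq_of_weightedMean_eq {ι : Type*} [Fintype ι] {a f : ι → ℝ} {c : ℝ} (h0 : ∀ t, 0 ≤ a t)
    (h1 : ∑ t, a t = 1) (hf : ∑ t, a t * f t = c) (hle : ∀ t, f t ≤ c) {t : ι} (ht : a t ≠ 0) :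
    f t = c := by
  have hz : ∑ t, a t * (c - f t) = 0 := by
    simp only [mul_sub, Finset.sum_sub_distrib, hf, ← Finset.sum_mul, h1]
    ring
  rw [Finset.sum_eq_zero_iff_of_nonneg
    fun t _ => mul_nonneg (h0 t) (sub_nonneg.2 (hle t))] at hz
  rcases mul_eq_zero.1 (hz t (Finset.mem_univ t)) with h | h
  · exact absurd h ht
  · linarith

theorem exists_weights_of_mem_convexHull_range {κ E : Type*} [AddCommGroup E] [Module ℝ E]
    {v : κ → E} {x : E} (hx : x ∈ convexHull ℝ (Set.range v)) :
    ∃ (ι : Type) (_ : Fintype ι) (a : ι → ℝ) (b : ι → κ),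
      (∀ t, 0 ≤ a t) ∧ ∑ t, a t = 1 ∧ ∑ t, a t • v (b t) = x := by
  obtain ⟨ι, _, a, z, h0, h1, hz, hx⟩ := mem_convexHull_iff_exists_fintype.1 hx
  choose b hb using hz
  exact ⟨ι, inferInstance, a, b, h0, h1, by simpa only [hb] using hx⟩

theorem exists_weight_ne_zero {ι : Type*} [Fintype ι] {a : ι → ℝ} (h1 : ∑ t, a t = 1) :
    ∃ t, a t ≠ 0 := by
  by_contra! h
  simp [h] at h1

/-- Coordinates of base vectors are at most 1, so a mean equal to 1 forces the value 1 wherever the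
weight is nonzero. The companion for the value 0 applies the same argument to the negated
coordinate. -/
theorem mem_of_weight_ne_zero {ι : Type*} [Fintype ι] {n : ℕ} {M : Matroid (Fin n)} {a : ι → ℝ}
    {b : ι → Bases M} {x : Fin n → ℝ} (h0 : ∀ t, 0 ≤ a t) (h1 : ∑ t, a t = 1)
    (hx : ∑ t, a t • baseVector M (b t) = x) {i : Fin n} (hi : x i = 1) {t : ι} (ht : a t ≠ 0) :
    i ∈ (b t).1 := by
  have h := congrFun hx i
  simp only [Finset.sum_apply, Pi.smul_apply, smul_eq_mul, hi] at h
  have := eq_of_weightedMean_eq h0 h1 h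
    (fun t => by unfold baseVector; split_ifs <;> norm_num) ht
  by_contra hn
  simp [baseVector, hn] at this

theorem notMem_of_weight_ne_zero {ι : Type*} [Fintype ι] {n : ℕ} {M : Matroid (Fin n)} {a : ι → ℝ}
    {b : ι → Bases M} {x : Fin n → ℝ} (h0 : ∀ t, 0 ≤ a t) (h1 : ∑ t, a t = 1)
    (hx : ∑ t, a t • baseVector M (b t) = x) {i : Fin n} (hi : x i = 0) {t : ι} (ht : a t ≠ 0) :
    i ∉ (b t).1 := by
  have h := congrFun hx i
  simp only [Finset.sum_apply, Pi.smul_apply, smul_eq_mul, hi] at h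
  have := eq_of_weightedMean_eq (f := fun t => - baseVector M (b t) i) (c := 0) h0 h1
    (by simpa using h) (fun t => by unfold baseVector; split_ifs <;> norm_num) ht
  intro hn
  simp [baseVector, hn] at this

/-! ### Cells of a regular subdivision -/

/-- A base of a matroid whose polytope is a cell of the regular subdivision induced by `w` is a base
of the subdivided matroid, and it minimizes the functional defining the cell. -/
theorem isBase_of_cell {n : ℕ} {M N : Matroid (Fin n)} {w : Bases M → ℝ}
    {φ : (Fin n → ℝ) →ₗ[ℝ] ℝ}
    (hN : Prod.fst '' lowerFace (baseVector M) w φ = matroidPolytope N) (B : Bases N) :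
    ∃ hB : M.IsBase (B.1 : Set (Fin n)), ∀ C : Bases M,
      φ (baseVector N B) + w ⟨B.1, hB⟩ ≤ φ (baseVector M C) + w C := by
  have hmem : baseVector N B ∈ matroidPolytope N := subset_convexHull _ _ ⟨B, rfl⟩
  rw [← hN] at hmem
  obtain ⟨x, ⟨hx, hmin⟩, hxB⟩ := hmem
  obtain ⟨ι, _, a, b, h0, h1, hab⟩ := exists_weights_of_mem_convexHull_range hx
  have hfst : ∑ t, a t • baseVector M (b t) = baseVector N B := by
    rw [← hxB, ← hab, Prod.fst_sum]; rfl
  have hsnd : ∑ t, a t * w (b t) = x.2 := by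
    rw [← hab, Prod.snd_sum]; rfl
  -- A 0/1 vector is a vertex of the cube, so only copies of `B` carry weight; the lifted point
  -- therefore has height `w B`.
  have hb : ∀ t, a t ≠ 0 → (b t).1 = B.1 := by
    intro t ht
    ext i
    by_cases hi : i ∈ B.1
    · exact iff_of_true (mem_of_weight_ne_zero h0 h1 hfst (by simp [baseVector, hi]) ht) hi
    · exact iff_of_false (notMem_of_weight_ne_zero h0 h1 hfst (by simp [baseVector, hi]) ht) hi
  obtain ⟨t₀, ht₀⟩ := exists_weight_ne_zero h1
  have hB : M.IsBase (B.1 : Set (Fin n)) := hb t₀ ht₀ ▸ (b t₀).2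
  refine ⟨hB, fun C => ?_⟩
  have hw : x.2 = w ⟨B.1, hB⟩ := by
    rw [← hsnd, ← one_mul (w ⟨B.1, hB⟩), ← h1, Finset.sum_mul]
    refine Finset.sum_congr rfl fun t _ => ?_
    by_cases ht : a t = 0
    · simp [ht]
    · rw [show b t = ⟨B.1, hB⟩ from Subtype.ext (hb t ht)]
  rw [← hw, ← hxB]
  exact hmin (baseVector M C, w C) (subset_convexHull _ _ ⟨C, rfl⟩)

/-! ### Complementary pairs of bases -/

/-- Exchange `a` out of the first base: the incoming element lies in the second base but not in the
first, so it is `c` or `d`. -/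
theorem isBase_exchange_pair {n : ℕ} {N : Matroid (Fin n)} {S : Finset (Fin n)} {a b c d : Fin n}
    (ha : a ∉ S) (hab : a ≠ b) (hac : a ≠ c) (had : a ≠ d)
    (h : N.IsBase (S ∪ {a, b} : Finset (Fin n))) (h' : N.IsBase (S ∪ {c, d} : Finset (Fin n))) :
    N.IsBase (S ∪ {b, c} : Finset (Fin n)) ∨ N.IsBase (S ∪ {b, d} : Finset (Fin n)) := by
  obtain ⟨y, ⟨hy, hy'⟩, hB⟩ := h.exchange_mem h' (e := a) (by simp) (by simp [ha, hac, had])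
  have key : (insert y (((S ∪ {a, b} : Finset (Fin n)) : Set (Fin n)) \ {a}))
      = ((S ∪ {b, y} : Finset (Fin n)) : Set (Fin n)) := by
    ext z
    simp only [Finset.coe_union, Finset.coe_insert, Finset.coe_singleton, Set.mem_insert_iff,
      Set.mem_sdiff, Set.mem_union, Finset.mem_coe, Set.mem_singleton_iff]
    constructor
    · rintro (h | ⟨h | h | h, h'⟩) <;> tauto
    · rintro (h | h | h)
      · exact Or.inr ⟨Or.inl h, fun hz => ha (hz ▸ h)⟩
      · exact Or.inr ⟨Or.inr (Or.inr h), fun hz => hab (hz.symm.trans h)⟩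
      · exact Or.inl h
  rw [key] at hB
  simp only [Finset.coe_union, Finset.coe_insert, Finset.coe_singleton, Set.mem_insert_iff,
    Set.mem_union, Finset.mem_coe, Set.mem_singleton_iff] at hy hy'
  rcases hy with hy | rfl | rfl
  · exact absurd (Or.inl hy) hy'
  · exact Or.inl hB
  · exact Or.inr hB

/-- A complementary pair of bases containing `S` yields a second such pair. -/
theorem isBase_complementary_pair {n : ℕ} {N : Matroid (Fin n)} {S : Finset (Fin n)}
    {a b c d : Fin n} (hd : [a, b, c, d].Nodup) (ha : a ∉ S) (hb : b ∉ S) (hc : c ∉ S) (hdS : d ∉ S)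
    (h : N.IsBase (S ∪ {a, b} : Finset (Fin n))) (h' : N.IsBase (S ∪ {c, d} : Finset (Fin n))) :
    (N.IsBase (S ∪ {a, c} : Finset (Fin n)) ∧ N.IsBase (S ∪ {b, d} : Finset (Fin n))) ∨
      (N.IsBase (S ∪ {a, d} : Finset (Fin n)) ∧ N.IsBase (S ∪ {b, c} : Finset (Fin n))) := by
  simp only [List.nodup_cons, List.mem_cons, List.not_mem_nil, or_false, not_or] at hd
  obtain ⟨⟨hab, hac, had⟩, ⟨hbc, hbd⟩, hcd, -⟩ := hd
  -- On the 4-cycle with edges `ac`, `ad`, `bc`, `bd`, the four exchanges say that every vertex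
  -- meets an edge giving a base. Such a set of edges contains a perfect matching, which is the
  -- claim.
  have h1 := isBase_exchange_pair ha hab hac had h h'
  have h2 := isBase_exchange_pair hb (Ne.symm hab) hbc hbd (Finset.pair_comm a b ▸ h) h'
  have h3 := isBase_exchange_pair hc hcd (Ne.symm hac) (Ne.symm hbc) h' h
  have h4 := isBase_exchange_pair hdS (Ne.symm hcd) (Ne.symm had) (Ne.symm hbd)
    (Finset.pair_comm c d ▸ h') h
  rw [Finset.pair_comm d a, Finset.pair_comm d b] at h3
  rw [Finset.pair_comm c a, Finset.pair_comm c b] at h4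
  tauto

/-- The centre of the octahedron with vertices `e_{S ∪ T}`, `T` a pair in `{i, j, k, l}`. -/
noncomputable def octahedronCenter {n : ℕ} (S : Finset (Fin n)) (i j k l : Fin n) : Fin n → ℝ :=
  fun x => if x ∈ S then 1 else if x = i ∨ x = j ∨ x = k ∨ x = l then 1 / 2 else 0

/-- Elements of `S` are counted twice and the other four once, whatever the pairing. Hence a linear
functional has the same sum on all complementary pairs. -/
theorem baseVector_add_baseVector {n : ℕ} {N : Matroid (Fin n)} {S : Finset (Fin n)}
    {i j k l a b c d : Fin n} (hd : [a, b, c, d].Nodup) (hp : [a, b, c, d].Perm [i, j, k, l])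
    (ha : a ∉ S) (hb : b ∉ S) (hc : c ∉ S) (hdS : d ∉ S)
    (h : N.IsBase (S ∪ {a, b} : Finset (Fin n))) (h' : N.IsBase (S ∪ {c, d} : Finset (Fin n))) :
    baseVector N ⟨_, h⟩ + baseVector N ⟨_, h'⟩ = (2 : ℝ) • octahedronCenter S i j k l := by
  ext x
  have hx := hp.mem_iff (a := x)
  simp only [List.nodup_cons, List.mem_cons, List.not_mem_nil, or_false, not_or] at hd hx
  obtain ⟨⟨hab, hac, had⟩, ⟨hbc, hbd⟩, hcd, -⟩ := hd
  simp only [Pi.add_apply, Pi.smul_apply, smul_eq_mul, baseVector, octahedronCenter, ← hx,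
    Finset.mem_union, Finset.mem_insert, Finset.mem_singleton]
  by_cases hxS : x ∈ S
  · simp [hxS]; norm_num
  · by_cases h1 : x = a
    · subst h1; simp [*]
    by_cases h2 : x = b
    · subst h2; simp [*]
    by_cases h3 : x = c
    · subst h3; simp [*]
    by_cases h4 : x = d
    · subst h4; simp [*]
    simp [*]

/-- If the centre of the octahedron lies in the polytope of a matroid, then this matroid has a
complementary pair of bases in the octahedron. -/
theorem exists_complementary_pair {n : ℕ} {N : Matroid (Fin n)} {S : Finset (Fin n)}
    {i j k l : Fin n} (hd : [i, j, k, l].Nodup) (hi : i ∉ S) (hj : j ∉ S) (hk : k ∉ S) (hl : l ∉ S)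
    (hcard : ∀ B : Bases N, B.1.card = S.card + 2)
    (hm : octahedronCenter S i j k l ∈ matroidPolytope N) :
    ∃ a b c d, [a, b, c, d].Perm [i, j, k, l] ∧
      N.IsBase (S ∪ {a, b} : Finset (Fin n)) ∧ N.IsBase (S ∪ {c, d} : Finset (Fin n)) := by
  obtain ⟨ι, _, p, B, h0, h1, hB⟩ := exists_weights_of_mem_convexHull_range hm
  -- a base of nonzero weight consists of `S` and a pair
  have hpair : ∀ t, p t ≠ 0 → ∀ a b c d, [a, b, c, d].Perm [i, j, k, l] → c ∉ (B t).1 →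
      d ∉ (B t).1 → (B t).1 = S ∪ {a, b} := by
    intro t ht a b c d hp hc hdB
    refine Finset.eq_of_subset_of_card_le (fun x hx => ?_) ?_
    · by_contra hn
      simp only [Finset.mem_union, Finset.mem_insert, Finset.mem_singleton, not_or] at hn
      refine notMem_of_weight_ne_zero h0 h1 hB (i := x) ?_ ht hx
      have hxp := hp.mem_iff (a := x)
      simp only [List.mem_cons, List.not_mem_nil, or_false] at hxp
      have : x ≠ c := fun h => hc (h ▸ hx)
      have : x ≠ d := fun h => hdB (h ▸ hx)
      simp only [octahedronCenter, ← hxp]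
      simp [*]
    · rw [hcard]
      exact (Finset.card_union_le _ _).trans (by have := Finset.card_le_two (a := a) (b := b); omega)
  have hsum : ∀ a b, a ∈ [i, j, k, l] → b ∈ [i, j, k, l] →
      ∑ t, p t * (baseVector N (B t) a + baseVector N (B t) b) = 1 := by
    have hhalf : ∀ a ∈ [i, j, k, l], ∑ t, p t * baseVector N (B t) a = 1 / 2 := by
      intro a ha
      have h := congrFun hB a
      simp only [Finset.sum_apply, Pi.smul_apply, smul_eq_mul] at h
      rw [h]
      simp only [List.mem_cons, List.not_mem_nil, or_false] at ha
      have haS : a ∉ S := by rcases ha with rfl | rfl | rfl | rfl <;> assumption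
      simp [octahedronCenter, haS, ha]
    intro a b ha hb
    simp only [mul_add, Finset.sum_add_distrib, hhalf a ha, hhalf b hb]
    norm_num
  obtain ⟨t, ht⟩ := exists_weight_ne_zero h1
  obtain ⟨a, b, c, d, hp, hBt, haB, hbB⟩ : ∃ a b c d, [a, b, c, d].Perm [i, j, k, l] ∧
      (B t).1 = S ∪ {a, b} ∧ a ∈ (B t).1 ∧ b ∈ (B t).1 := by
    have hS : S ⊆ (B t).1 := fun x hx =>
      mem_of_weight_ne_zero h0 h1 hB (by simp [octahedronCenter, hx]) ht
    have h2 : ((B t).1 \ S).card = 2 := by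
      rw [Finset.card_sdiff_of_subset hS, hcard]; omega
    obtain ⟨a, b, hab, hD⟩ := Finset.card_eq_two.1 h2
    have hmem : ∀ x ∈ (B t).1 \ S, x ∈ (B t).1 ∧ x ∈ [i, j, k, l] := by
      intro x hx
      rw [Finset.mem_sdiff] at hx
      refine ⟨hx.1, ?_⟩
      by_contra hn
      simp only [List.mem_cons, List.not_mem_nil, or_false] at hn
      exact notMem_of_weight_ne_zero h0 h1 hB (by simp [octahedronCenter, hx.2, hn]) ht hx.1
    have ha := hmem a (by simp [hD])
    have hb := hmem b (by simp [hD])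
    have hb' : b ∈ [i, j, k, l].erase a := (List.mem_erase_of_ne hab.symm).2 hb.2
    obtain ⟨c, d, hcd⟩ : ∃ c d, ([i, j, k, l].erase a).erase b = [c, d] := by
      refine List.length_eq_two.1 ?_
      rw [List.length_erase_of_mem hb', List.length_erase_of_mem ha.2]
      rfl
    refine ⟨a, b, c, d, ?_, ?_, ha.1, hb.1⟩
    · rw [← hcd]
      exact ((List.perm_cons_erase ha.2).trans ((List.perm_cons_erase hb').cons a)).symm
    · rw [← hD, Finset.union_sdiff_of_subset hS]
  refine ⟨a, b, c, d, hp, hBt ▸ (B t).2, ?_⟩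
  have hs := hsum a b (hp.mem_iff.1 (by simp)) (hp.mem_iff.1 (by simp))
  -- The sum of coordinates `a` and `b` has mean 1 but equals 2 at `B t`, so it drops below 1 at
  -- some base of nonzero weight. That base avoids `a` and `b`, so it is `S ∪ {c, d}`.
  obtain ⟨s, hps, hs⟩ : ∃ s, p s ≠ 0 ∧ baseVector N (B s) a + baseVector N (B s) b < 1 := by
    by_contra! hcon
    have := eq_of_weightedMean_eq
      -- Nothing bounds the sum at indices of weight zero; the value -1 there keeps the required
      -- bound and leaves the mean unchanged.
      (f := fun s => if p s = 0 then -1 else -(baseVector N (B s) a + baseVector N (B s) b))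
      (c := -1) h0 h1 ?_ ?_ ht
    · simp [ht, baseVector, haB, hbB] at this
    · rw [← hs, ← Finset.sum_neg_distrib]
      refine Finset.sum_congr rfl fun s _ => ?_
      split_ifs with h
      · simp [h]
      · ring
    · intro s
      split_ifs with h
      · exact le_rfl
      · linarith [hcon s h]
  have hnot : a ∉ (B s).1 ∧ b ∉ (B s).1 := by
    unfold baseVector at hs
    constructor <;> intro h <;> simp only [h, if_true] at hs <;> split_ifs at hs <;> linarith
  have := hpair s hps c d a b (List.Perm.trans (List.perm_append_comm (l₁ := [c, d]) (l₂ := [a, b])) hp)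
    hnot.1 hnot.2
  exact this ▸ (B s).2

/-! ### Tropical three-term Plücker relations -/

/-- The exponent vector of the monomial `p_A p_B`. -/
noncomputable def pairExponent {n : ℕ} {M : Matroid (Fin n)} (A B : Bases M) : Bases M →₀ ℕ :=
  Finsupp.single A 1 + Finsupp.single B 1

theorem pairExponent_comm {n : ℕ} {M : Matroid (Fin n)} (A B : Bases M) :
    pairExponent A B = pairExponent B A := add_comm _ _

theorem tropMonomial_pairExponent {n : ℕ} {M : Matroid (Fin n)} (A B : Bases M) (w : Bases M → ℝ) :
    tropMonomial (pairExponent A B) w = w A + w B := by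
  unfold tropMonomial pairExponent
  rw [Finsupp.sum_add_index' (by simp) (by intros; push_cast; ring)]
  simp

theorem mem_or_mem_of_pairExponent_eq {n : ℕ} {M : Matroid (Fin n)} {A B C D : Bases M}
    (h : pairExponent A B = pairExponent C D) : A = C ∨ A = D := by
  by_contra! hn
  have := DFunLike.congr_fun h A
  simp [pairExponent, hn.1.symm, hn.2.symm] at this

/-- The sets `A` and `B` are bases of `M`, and `e` is the exponent vector of `p_A p_B`. -/
def IsPluckerPair {n : ℕ} {M : Matroid (Fin n)} (e : Bases M →₀ ℕ) (A B : Finset (Fin n)) : Prop :=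
  ∃ hA hB, pairExponent (M := M) ⟨A, hA⟩ ⟨B, hB⟩ = e

theorem coeff_restrictToBases_mul {n : ℕ} {M : Matroid (Fin n)} (A B : Finset (Fin n))
    (e : Bases M →₀ ℕ) [Decidable (IsPluckerPair e A B)] :
    (restrictToBases M (MvPolynomial.X A * MvPolynomial.X B)).coeff e
      = if IsPluckerPair e A B then 1 else 0 := by
  classical
  rw [restrictToBases, map_mul, MvPolynomial.aeval_X, MvPolynomial.aeval_X]
  by_cases hA : M.IsBase (A : Set (Fin n))
  · by_cases hB : M.IsBase (B : Set (Fin n))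
    · rw [dif_pos hA, dif_pos hB, MvPolynomial.X, MvPolynomial.X, MvPolynomial.monomial_mul,
        MvPolynomial.coeff_monomial]
      simp [IsPluckerPair, hA, hB, pairExponent]
    · simp [IsPluckerPair, hB]
  · simp [IsPluckerPair, hA]

theorem IsPluckerPair.mem_or_mem {n : ℕ} {M : Matroid (Fin n)} {e : Bases M →₀ ℕ}
    {A B C D : Finset (Fin n)} (h : IsPluckerPair e A B) (h' : IsPluckerPair e C D) :
    A = C ∨ A = D := by
  obtain ⟨hA, hB, rfl⟩ := h
  obtain ⟨hC, hD, h'⟩ := h'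
  simpa using mem_or_mem_of_pairExponent_eq h'.symm

theorem IsPluckerPair.symm {n : ℕ} {M : Matroid (Fin n)} {e : Bases M →₀ ℕ}
    {A B : Finset (Fin n)} (h : IsPluckerPair e A B) : IsPluckerPair e B A := by
  obtain ⟨hA, hB, h⟩ := h
  exact ⟨hB, hA, pairExponent_comm _ _ ▸ h⟩

theorem union_pair_ne {n : ℕ} {S : Finset (Fin n)} {a b c d : Fin n} (ha : a ∉ S) (hac : a ≠ c)
    (had : a ≠ d) : S ∪ {a, b} ≠ S ∪ {c, d} := by
  intro h
  have : a ∈ S ∪ {c, d} := h ▸ by simp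
  simp [ha, hac, had] at this

/-- Two different pairings of four elements outside `S` give different monomials. -/
theorem not_isPluckerPair_and {n : ℕ} {M : Matroid (Fin n)} {e : Bases M →₀ ℕ}
    {S : Finset (Fin n)} {a b c d : Fin n} (hd : [a, b, c, d].Nodup) (ha : a ∉ S) (hb : b ∉ S) :
    ¬ (IsPluckerPair e (S ∪ {a, b}) (S ∪ {c, d}) ∧ IsPluckerPair e (S ∪ {a, c}) (S ∪ {b, d})) := by
  rintro ⟨h, h'⟩
  simp only [List.nodup_cons, List.mem_cons, List.not_mem_nil, or_false, not_or] at hd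
  obtain ⟨⟨hab, hac, had⟩, ⟨hbc, hbd⟩, hcd, -⟩ := hd
  rcases h.mem_or_mem h' with h | h
  · rw [Finset.pair_comm a b] at h
    exact union_pair_ne hb (Ne.symm hab) hbc h
  · exact union_pair_ne ha hab had h

/-- The three products never share a monomial, so nothing cancels and the signs play no role. -/
theorem mem_support_pluckerRelation {n : ℕ} {M : Matroid (Fin n)} {e : Bases M →₀ ℕ}
    {S : Finset (Fin n)} {i j k l : Fin n} (hd : [i, j, k, l].Nodup)
    (hi : i ∉ S) (hj : j ∉ S) (hl : l ∉ S) :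
    e ∈ (restrictToBases M (pluckerRelation S i j k l)).support ↔
      IsPluckerPair e (S ∪ {i, j}) (S ∪ {k, l}) ∨ IsPluckerPair e (S ∪ {i, k}) (S ∪ {j, l}) ∨
        IsPluckerPair e (S ∪ {i, l}) (S ∪ {j, k}) := by
  classical
  have h12 := not_isPluckerPair_and (e := e) hd hi hj
  have h13 := not_isPluckerPair_and (e := e) (a := i) (b := j) (c := l) (d := k)
    (by simp at hd ⊢; grind) hi hj
  have h23 := not_isPluckerPair_and (e := e) (a := i) (b := l) (c := k) (d := j)
    (by simp at hd ⊢; grind) hi hl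
  rw [Finset.pair_comm l k] at h13
  rw [Finset.pair_comm l j, Finset.pair_comm k j] at h23
  rw [MvPolynomial.mem_support_iff, pluckerRelation, map_add, map_sub, MvPolynomial.coeff_add,
    MvPolynomial.coeff_sub, coeff_restrictToBases_mul, coeff_restrictToBases_mul,
    coeff_restrictToBases_mul]
  split_ifs <;> simp_all

/-- Every complementary pair of bases gives a monomial of the restricted Plücker relation. -/
theorem pairExponent_mem_support {n : ℕ} {M : Matroid (Fin n)} {S : Finset (Fin n)}
    {i j k l a b c d : Fin n} (hd : [i, j, k, l].Nodup) (hi : i ∉ S) (hj : j ∉ S) (hl : l ∉ S)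
    (hp : [a, b, c, d].Perm [i, j, k, l])
    (h : M.IsBase (S ∪ {a, b} : Finset (Fin n))) (h' : M.IsBase (S ∪ {c, d} : Finset (Fin n))) :
    pairExponent (M := M) ⟨_, h⟩ ⟨_, h'⟩
      ∈ (restrictToBases M (pluckerRelation S i j k l)).support := by
  rw [mem_support_pluckerRelation hd hi hj hl]
  have hpp : IsPluckerPair (pairExponent (M := M) ⟨_, h⟩ ⟨_, h'⟩) (S ∪ {a, b}) (S ∪ {c, d}) :=
    ⟨h, h', rfl⟩
  generalize pairExponent (M := M) ⟨_, h⟩ ⟨_, h'⟩ = e at hpp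
  have hpd := hp.nodup_iff.2 hd
  have hmem := fun x => hp.mem_iff (a := x)
  simp only [List.nodup_cons, List.mem_cons, List.not_mem_nil, or_false, not_or] at hpd hmem
  obtain ⟨⟨hab, hac, had⟩, ⟨hbc, hbd⟩, hcd, -⟩ := hpd
  have := hpp.symm
  have c1 := Finset.pair_comm a b
  have c2 := Finset.pair_comm c d
  -- Assignments with a repetition contradict distinctness. Each remaining one is one of the three
  -- pairings, up to order inside the pairs and order of the two pairs.
  rcases (hmem a).1 (by simp) with rfl | rfl | rfl | rfl <;>
  rcases (hmem b).1 (by simp) with rfl | rfl | rfl | rfl <;>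
  rcases (hmem c).1 (by simp) with rfl | rfl | rfl | rfl <;>
  rcases (hmem d).1 (by simp) with rfl | rfl | rfl | rfl <;>
  first
    | contradiction
    | simp_all

theorem exists_pair_of_mem_support {n : ℕ} {M : Matroid (Fin n)} {e : Bases M →₀ ℕ}
    {S : Finset (Fin n)} {i j k l : Fin n} (hd : [i, j, k, l].Nodup)
    (hi : i ∉ S) (hj : j ∉ S) (hl : l ∉ S)
    (he : e ∈ (restrictToBases M (pluckerRelation S i j k l)).support) :
    ∃ a b c d, [a, b, c, d].Perm [i, j, k, l] ∧ IsPluckerPair e (S ∪ {a, b}) (S ∪ {c, d}) := by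
  rcases (mem_support_pluckerRelation hd hi hj hl).1 he with h | h | h
  · exact ⟨i, j, k, l, List.Perm.refl _, h⟩
  · exact ⟨i, k, j, l, (List.Perm.swap j k [l]).cons i, h⟩
  · exact ⟨i, l, j, k, (List.perm_append_comm (l₁ := [l]) (l₂ := [j, k])).cons i, h⟩

/-! ### Membership in the local Dressian -/

/-- Weights inducing a subdivision whose maximal cells are matroid polytopes lie in the local
Dressian. -/
theorem mem_localDressian_of_matroidal {n : ℕ} {M : Matroid (Fin n)} {w : Bases M → ℝ}
    (hfin : (inducedSubdivision (baseVector M) w).Finite)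
    (hcov : ⋃₀ inducedSubdivision (baseVector M) w = matroidPolytope M)
    (hmax : ∀ F, Maximal (· ∈ inducedSubdivision (baseVector M) w) F →
      ∃ N : Matroid (Fin n), F = matroidPolytope N) :
    w ∈ localDressian M := by
  intro S i j k l hr hij hjk hkl hi hj hk hl e he hmin
  have hd : [i, j, k, l].Nodup := by
    simp only [List.nodup_cons, List.mem_cons, List.not_mem_nil, or_false, not_or]
    exact ⟨⟨hij.ne, (hij.trans hjk).ne, (hij.trans (hjk.trans hkl)).ne⟩,
      ⟨hjk.ne, (hjk.trans hkl).ne⟩, hkl.ne, not_false, List.nodup_nil⟩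
  have hout : ∀ x ∈ [i, j, k, l], x ∉ S := by
    intro x hx
    simp only [List.mem_cons, List.not_mem_nil, or_false] at hx
    rcases hx with rfl | rfl | rfl | rfl <;> assumption
  obtain ⟨a, b, c, d, hp, hA, hB, rfl⟩ := exists_pair_of_mem_support hd hi hj hl he
  have hadd : ∀ {N : Matroid (Fin n)} {a b c d : Fin n}, [a, b, c, d].Perm [i, j, k, l] →
      ∀ (h : N.IsBase (S ∪ {a, b} : Finset (Fin n))) (h' : N.IsBase (S ∪ {c, d} : Finset (Fin n))),
      baseVector N ⟨_, h⟩ + baseVector N ⟨_, h'⟩ = (2 : ℝ) • octahedronCenter S i j k l :=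
    fun hp h h' => baseVector_add_baseVector (hp.nodup_iff.2 hd) hp
      (hout _ (hp.mem_iff.1 (by simp))) (hout _ (hp.mem_iff.1 (by simp)))
      (hout _ (hp.mem_iff.1 (by simp))) (hout _ (hp.mem_iff.1 (by simp))) h h'
  have hm : octahedronCenter S i j k l ∈ matroidPolytope M := by
    have hmid : octahedronCenter S i j k l
        = (1 / 2 : ℝ) • baseVector M ⟨_, hA⟩ + (1 / 2 : ℝ) • baseVector M ⟨_, hB⟩ := by
      rw [← smul_add, hadd hp hA hB, smul_smul]
      norm_num
    rw [hmid]
    exact convex_convexHull ℝ _ (subset_convexHull _ _ (Set.mem_range_self _)) (subset_convexHull _ _ (Set.mem_range_self _))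
      (by norm_num) (by norm_num) (by norm_num)
  rw [← hcov] at hm
  obtain ⟨F, hF, hmF⟩ := hm
  -- Finiteness puts the cell in a maximal one, which is nonempty because it contains the centre, so
  -- it comes from a functional `φ`.
  obtain ⟨G, hFG, hG⟩ := hfin.exists_le_maximal hF
  obtain ⟨N, rfl⟩ := hmax G hG
  have hmN := hFG hmF
  obtain ⟨φ, hφ⟩ : ∃ φ, Prod.fst '' lowerFace (baseVector M) w φ = matroidPolytope N := by
    rcases hG.prop with h | h
    · rw [h] at hmN
      exact hmN.elim
    · exact h
  have hcell := isBase_of_cell hφ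
  have hcard : ∀ B : Bases N, B.1.card = S.card + 2 := by
    intro B
    have h := (hcell B).1.encard_eq_eRank
    rw [← hr, Set.encard_coe_eq_coe_finsetCard] at h
    exact_mod_cast h
  -- complementary pairs of bases of the cell attain the minimum
  have hpairs : ∀ a' b' c' d', [a', b', c', d'].Perm [i, j, k, l] →
      N.IsBase (S ∪ {a', b'} : Finset (Fin n)) → N.IsBase (S ∪ {c', d'} : Finset (Fin n)) →
      ∃ e' ∈ (restrictToBases M (pluckerRelation S i j k l)).support,
        IsPluckerPair e' (S ∪ {a', b'}) (S ∪ {c', d'}) ∧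
        tropMonomial e' w = tropMonomial (pairExponent ⟨_, hA⟩ ⟨_, hB⟩) w := by
    intro a' b' c' d' hp' h h'
    obtain ⟨hM, hle⟩ := hcell ⟨_, h⟩
    obtain ⟨hM', hle'⟩ := hcell ⟨_, h'⟩
    have hsupp := pairExponent_mem_support hd hi hj hl hp' hM hM'
    refine ⟨_, hsupp, ⟨hM, hM', rfl⟩, le_antisymm ?_ (hmin _ hsupp)⟩
    rw [tropMonomial_pairExponent, tropMonomial_pairExponent]
    have h1 := hle ⟨_, hA⟩
    have h2 := hle' ⟨_, hB⟩
    -- The values of `φ` cancel when the two minimality inequalities are added, leaving only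
    -- weights.
    have h3 := congrArg φ ((hadd hp' h h').trans (hadd hp hA hB).symm)
    rw [map_add, map_add] at h3
    linarith
  obtain ⟨a', b', c', d', hp', h, h'⟩ := exists_complementary_pair hd hi hj hk hl hcard hmN
  have hd' := hp'.nodup_iff.2 hd
  have ha' := hout a' (hp'.mem_iff.1 (by simp))
  have hb' := hout b' (hp'.mem_iff.1 (by simp))
  obtain ⟨e₁, he₁, hpl₁, ht₁⟩ := hpairs a' b' c' d' hp' h h'
  obtain ⟨e₂, he₂, hne, ht₂⟩ : ∃ e₂ ∈ (restrictToBases M (pluckerRelation S i j k l)).support,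
      e₂ ≠ e₁ ∧ tropMonomial e₂ w = tropMonomial (pairExponent ⟨_, hA⟩ ⟨_, hB⟩) w := by
    rcases isBase_complementary_pair hd' ha' hb' (hout c' (hp'.mem_iff.1 (by simp)))
      (hout d' (hp'.mem_iff.1 (by simp))) h h' with ⟨g, g'⟩ | ⟨g, g'⟩
    · obtain ⟨e₂, he₂, hpl₂, ht₂⟩ :=
        hpairs a' c' b' d' (((List.Perm.swap b' c' [d']).cons a').trans hp') g g'
      refine ⟨e₂, he₂, ?_, ht₂⟩
      rintro rfl
      exact not_isPluckerPair_and hd' ha' hb' ⟨hpl₁, hpl₂⟩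
    · obtain ⟨e₂, he₂, hpl₂, ht₂⟩ := hpairs a' d' b' c'
        (((List.perm_append_comm (l₁ := [d']) (l₂ := [b', c'])).cons a').trans hp') g g'
      refine ⟨e₂, he₂, ?_, ht₂⟩
      rintro rfl
      rw [Finset.pair_comm c' d'] at hpl₁
      exact not_isPluckerPair_and
        ((((List.Perm.swap c' d' []).cons b').cons a').nodup_iff.2 hd') ha' hb' ⟨hpl₁, hpl₂⟩
  by_cases hee : e₁ = pairExponent ⟨_, hA⟩ ⟨_, hB⟩
  · exact ⟨e₂, he₂, hee ▸ hne, ht₂⟩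
  · exact ⟨e₁, he₁, hee, ht₁⟩

theorem corollary3p8 {r n : ℕ} (P Q : NEPath r n) (hPQ : ∀ j, P j ≤ Q j)
    (S : Set (Set (Fin n → ℝ))) (hS : IsLPMSubdivision (latticePathMatroid P Q hPQ) S)
    (w : Bases (latticePathMatroid P Q hPQ) → ℝ)
    (hw : IsWeightVectorFor (latticePathMatroid P Q hPQ) w S) :
    w ∈ localDressian (latticePathMatroid P Q hPQ) := by
  obtain rfl : _ = S := hw
  exact mem_localDressian_of_matroidal hS.1.finite hS.1.covers fun F hF =>
    let ⟨N, _, hN⟩ := hS.2 F hF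
    ⟨N, hN⟩
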